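/- Let $\mathcal S\subset\mathbb R^n$ and $\mathcal A\subset\mathbb R^d$ be compact, let $\mu$ be a Borel probability measure on $\mathcal S$ (initial distribution), $P(\cdot\mid s,a)$ a Markov transition kernel from $\mathcal S\times\mathcal A$ to $\mathcal S$, $\gamma\in(0,1)$, $\beta\in(0,1]$, and $m\ge 0$. A policy is a (stationary, randomized) Markov kernel $\pi(\cdot\mid s)$ from $\mathcal S$ to $\mathcal A$; $(s^\pi_\tau,a^\pi_\tau)_{\tau\ge0}$ denotes the trajectory with $s_0\sim\mu$, $a_\tau\sim\pi(\cdot\mid s_\tau)$, $s_{\tau+1}\sim P(\cdot\mid s_\tau,a_\tau)$. Let $r_0,\dots,r_m:\mathcal S\times\mathcal A\to\mathbb R$ be bounded and Borel measurable, let $c\in\mathbb R^m$, and fix $t=(t_0,\dots,t_m)\in\mathbb R^{m+1}$. Put $r_i'(s,a,t_i)=t_i-\frac1\beta(t_i-r_i(s,a))_+$ and $$V_i(\pi)=\mathbb E\Big[\sum_{\tau=0}^\infty\gamma^\tau r_i'(s_\tau^\pi,a_\tau^\pi,t_i)\Big],\qquad 0\le i\le m,$$ and consider the problem $$P^*=\sup_\pi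 V_0(\pi)\quad\text{s.t.}\quad V_i(\pi)\ge c_i,\ i=1,\dots,m,$$ with Lagrangian $\mathcal L(\pi,t,\lambda)=V_0(\pi)+\sum_{i=1}^m\lambda_i\,(V_i(\pi)-c_i)$. Assume Slater's condition: there is a policy $\pi$ with $V_i(\pi)>c_i$ for all $i=1,\dots,m$. Then the problem has strong duality, i.e. $$P^*=\inf_{\lambda\ge0}\sup_\pi\mathcal L(\pi,t,\lambda),$$ the infimum over $\lambda\in\mathbb R^m_{\ge 0}$ is attained, and thus $$\sup_\pi\inf_{\lambda\ge0}\mathcal L(\pi,t,\lambda)=\inf_{\lambda\ge0}\sup_\pi\mathcal L(\pi,t,\lambda).$$ -/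

import Mathlib

open MeasureTheory ProbabilityTheory

/-- A discounted Markov decision process with measurable state space `S` and action space `A`:
an initial state distribution, a transition kernel giving the law of the next state from the
current state-action pair, and a discount factor in `(0, 1)`. -/
structure DiscountedMDP (S A : Type*) [MeasurableSpace S] [MeasurableSpace A] where
  /-- law of the initial state `s_0` -/
  init : Measure S
  isProbabilityMeasure_init : IsProbabilityMeasure init
  /-- law of `s_{τ+1}` given `(s_τ, a_τ)` -/
  trans : Kernel (S × A) S
  isMarkovKernel_trans : IsMarkovKernel trans
  /-- discount factor -/
  γ : ℝ
  γ_pos : 0 < γ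
  γ_lt_one : γ < 1

attribute [instance] DiscountedMDP.isProbabilityMeasure_init DiscountedMDP.isMarkovKernel_trans

/-- A (stationary, randomized) policy: a measurable family `π(· | s)` of probability distributions
on the action space, indexed by the states. -/
structure Policy (S A : Type*) [MeasurableSpace S] [MeasurableSpace A] where
  kernel : Kernel S A
  isMarkovKernel_kernel : IsMarkovKernel kernel

attribute [instance] Policy.isMarkovKernel_kernel

/-- The modified reward `r'(s, a, t) = t - (1 / β) (t - r(s, a))_+`. -/
noncomputable def modifiedReward {X : Type*} (β : ℝ) (r : X → ℝ) (t : ℝ) : X → ℝ :=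
  fun x => t - (1 / β) * max (t - r x) 0

namespace DiscountedMDP

variable {S A : Type*} [MeasurableSpace S] [MeasurableSpace A]

/-- Transition kernel of the Markov chain `(s_τ, a_τ)` under the policy `π`:
`s_{τ+1} ~ trans(s_τ, a_τ)`, then `a_{τ+1} ~ π(s_{τ+1})`. -/
noncomputable def stepKernel (M : DiscountedMDP S A) (π : Policy S A) :
    Kernel (S × A) (S × A) :=
  M.trans ⊗ₖ Kernel.prodMkLeft (S × A) π.kernel

instance (M : DiscountedMDP S A) (π : Policy S A) : IsMarkovKernel (M.stepKernel π) := by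
  unfold stepKernel
  infer_instance

/-- Conditional law of `(s_{k+1}, a_{k+1})` given the whole history up to time `k`; it depends on
the last state-action pair only. -/
noncomputable def historyKernel (M : DiscountedMDP S A) (π : Policy S A) (k : ℕ) :
    Kernel (∀ _ : Finset.Iic k, S × A) (S × A) :=
  (M.stepKernel π).comap (fun h => h ⟨k, Finset.mem_Iic.2 le_rfl⟩) (measurable_pi_apply _)

instance (M : DiscountedMDP S A) (π : Policy S A) (k : ℕ) :
    IsMarkovKernel (M.historyKernel π k) := by
  unfold historyKernel
  infer_instance

/-- Law of the whole trajectory `(s_τ, a_τ)`, `τ = 0, 1, 2, …`, under the policy `π`, with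
`s_0 ~ init` and `a_0 ~ π(s_0)` (Ionescu-Tulcea). -/
noncomputable def pathLaw (M : DiscountedMDP S A) (π : Policy S A) : Measure (ℕ → S × A) :=
  Kernel.trajMeasure (X := fun _ => S × A) (M.init ⊗ₘ π.kernel) (M.historyKernel π)

/-- Expected discounted sum of rewards `E[∑_τ γ^τ f(s_τ, a_τ)]` under the policy `π`. -/
noncomputable def expectedReturn (M : DiscountedMDP S A) (f : S × A → ℝ) (π : Policy S A) : ℝ :=
  ∫ ω, ∑' τ : ℕ, M.γ ^ τ * f (ω τ) ∂(M.pathLaw π)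

/-- Value of the `i`-th modified reward under the policy `π`, for the parameters `t`. -/
noncomputable def riskValue (M : DiscountedMDP S A) {m : ℕ} (β : ℝ) (r : Fin (m + 1) → S × A → ℝ)
    (t : Fin (m + 1) → ℝ) (i : Fin (m + 1)) (π : Policy S A) : ℝ :=
  M.expectedReturn (modifiedReward β (r i) (t i)) π

/-- Feasibility of a policy for the fixed-`t` problem; index `0` is the objective and the indices
`i.succ` are the constraints. -/
def IsFeasible (M : DiscountedMDP S A) {m : ℕ} (β : ℝ) (r : Fin (m + 1) → S × A → ℝ)
    (c : Fin m → ℝ) (t : Fin (m + 1) → ℝ) (π : Policy S A) : Prop :=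
  ∀ i : Fin m, c i ≤ M.riskValue β r t i.succ π

/-- Slater's condition for the fixed-`t` problem: some policy satisfies every constraint
strictly. -/
def SlaterCondition (M : DiscountedMDP S A) {m : ℕ} (β : ℝ) (r : Fin (m + 1) → S × A → ℝ)
    (c : Fin m → ℝ) (t : Fin (m + 1) → ℝ) : Prop :=
  ∃ π : Policy S A, ∀ i : Fin m, c i < M.riskValue β r t i.succ π

/-- Lagrangian of the fixed-`t` problem. -/
noncomputable def lagrangian (M : DiscountedMDP S A) {m : ℕ} (β : ℝ)
    (r : Fin (m + 1) → S × A → ℝ) (c : Fin m → ℝ) (π : Policy S A) (t : Fin (m + 1) → ℝ)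
    (lam : Fin m → ℝ) : ℝ :=
  M.riskValue β r t 0 π + ∑ i : Fin m, lam i * (M.riskValue β r t i.succ π - c i)

/-- Optimal value of the fixed-`t` constrained problem. -/
noncomputable def primalValue (M : DiscountedMDP S A) {m : ℕ} (β : ℝ)
    (r : Fin (m + 1) → S × A → ℝ) (c : Fin m → ℝ) (t : Fin (m + 1) → ℝ) : EReal :=
  ⨆ (π : Policy S A) (_ : M.IsFeasible β r c t π), (M.riskValue β r t 0 π : EReal)

/-- Dual function of the fixed-`t` problem: `lam ↦ sup_π L(π, t, lam)`. -/
noncomputable def dualFunction (M : DiscountedMDP S A) {m : ℕ} (β : ℝ)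
    (r : Fin (m + 1) → S × A → ℝ) (c : Fin m → ℝ) (t : Fin (m + 1) → ℝ) (lam : Fin m → ℝ) :
    EReal :=
  ⨆ π : Policy S A, (M.lagrangian β r c π t lam : EReal)

/-- Optimal value of the Lagrangian dual of the fixed-`t` problem: `inf_{lam ≥ 0} sup_π L`. -/
noncomputable def dualValue (M : DiscountedMDP S A) {m : ℕ} (β : ℝ)
    (r : Fin (m + 1) → S × A → ℝ) (c : Fin m → ℝ) (t : Fin (m + 1) → ℝ) : EReal :=
  ⨅ (lam : Fin m → ℝ) (_ : 0 ≤ lam), M.dualFunction β r c t lam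

end DiscountedMDP

/-! The problem is not convex in the policy, but each value is a linear functional of the discounted
occupancy measure, and the occupancy measures form a convex set. Indeed, a finite measure is the
occupancy of `π` exactly when it solves the flow equation of `π` (`occupancy_eq`,
`eq_occupancy_of_flow`); the state marginal of that equation is affine and does not mention `π`, so
a mixture of two occupancies satisfies it too and is the occupancy of its own conditional kernel.
The attainable value vectors thus form a convex set, and separating it from the orthant of strict
improvements over `(p, c)`, with `p` the primal optimum, yields a multiplier; Slater's condition
makes the weight of the objective positive. -/

/-- Two-alternative theorem for convex sets in `ℝ^ι`: a nonempty convex set containing no vector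
with all coordinates positive lies in a half-space with nonnegative nonzero normal. -/
theorem exists_nonneg_sum_mul_nonpos_of_convex {ι : Type*} [Fintype ι] {C : Set (ι → ℝ)}
    (hC : Convex ℝ C) (hne : C.Nonempty) (hpos : ∀ x ∈ C, ∃ i, x i ≤ 0) :
    ∃ w : ι → ℝ, 0 ≤ w ∧ w ≠ 0 ∧ ∀ x ∈ C, ∑ i, w i * x i ≤ 0 := by
  classical
  have hD : Convex ℝ (Set.univ.pi fun _ : ι => Set.Ioi (0 : ℝ)) :=
    convex_pi fun _ _ => convex_Ioi 0
  have hDo : IsOpen (Set.univ.pi fun _ : ι => Set.Ioi (0 : ℝ)) :=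
    isOpen_set_pi Set.finite_univ fun _ _ => isOpen_Ioi
  have hdisj : Disjoint (Set.univ.pi fun _ : ι => Set.Ioi (0 : ℝ)) C := by
    rw [Set.disjoint_left]
    intro x hx hxC
    obtain ⟨i, hi⟩ := hpos x hxC
    exact absurd (hx i trivial) (not_lt.2 hi)
  obtain ⟨f, u, hfu, huf⟩ := geometric_hahn_banach_open hD hDo hC hdisj
  have hf : ∀ x : ι → ℝ, f x = ∑ i, f (Pi.single i 1) * x i := by
    intro x
    conv_lhs => rw [← Finset.univ_sum_single x, map_sum]
    refine Finset.sum_congr rfl fun i _ => ?_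
    have : Pi.single i (x i) = x i • (Pi.single i 1 : ι → ℝ) := by
      rw [← Pi.single_smul]; simp
    rw [this, map_smul, smul_eq_mul, mul_comm]
  -- the closed orthant is mapped below `u`
  have hcl : ∀ x : ι → ℝ, 0 ≤ x → f x ≤ u := by
    intro x hx
    have hlim : Filter.Tendsto (fun ε : ℝ => f (x + ε • 1)) (nhdsWithin 0 (Set.Ioi 0))
        (nhds (f x)) := by
      have : Continuous fun ε : ℝ => f (x + ε • (1 : ι → ℝ)) := by fun_prop
      simpa using (this.tendsto 0).mono_left nhdsWithin_le_nhds
    refine le_of_tendsto hlim ?_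
    filter_upwards [self_mem_nhdsWithin] with ε hε
    refine (hfu _ fun i _ => ?_).le
    have := hx i
    simp only [Set.mem_Ioi, Pi.zero_apply] at hε this ⊢
    simp only [Pi.add_apply, Pi.smul_apply, Pi.one_apply, smul_eq_mul, mul_one]
    linarith
  have hu : 0 ≤ u := by simpa using hcl 0 le_rfl
  have hw : ∀ i, f (Pi.single i 1) ≤ 0 := by
    intro i
    by_contra! h
    -- On the ray through the `i`-th basis vector `f` stays below `u`; this scaling would give it
    -- the value `u + 1`.
    have h1 := hcl (((u + 1) / f (Pi.single i 1)) • Pi.single i 1)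
      (smul_nonneg (by positivity) (by simp [Pi.single_nonneg]))
    rw [map_smul, smul_eq_mul, div_mul_cancel₀ _ h.ne'] at h1
    linarith
  refine ⟨fun i => -f (Pi.single i 1), fun i => by simpa using hw i, ?_, ?_⟩
  · intro h0
    have hz : ∀ x, f x = 0 := fun x => by
      rw [hf]
      refine Finset.sum_eq_zero fun i _ => ?_
      have := congrFun h0 i
      simp only [Pi.zero_apply, neg_eq_zero] at this
      rw [this, zero_mul]
    obtain ⟨x, hx⟩ := hne
    have h1 := hfu 1 (fun _ _ => by simp)
    have h2 := huf x hx
    rw [hz] at h1 h2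
    linarith
  · intro x hx
    have := huf x hx
    rw [hf] at this
    simp only [neg_mul, Finset.sum_neg_distrib]
    linarith

/-- Existence of a Lagrange multiplier for a concave-like program satisfying Slater's condition. -/
theorem exists_lagrange_multiplier {P : Type*} {m : ℕ} (V : Fin (m + 1) → P → ℝ) (c : Fin m → ℝ)
    (hconv : Convex ℝ (Set.range fun (π : P) (i : Fin (m + 1)) => V i π))
    (hslater : ∃ π, ∀ i : Fin m, c i < V i.succ π) (p : ℝ)
    (hp : ∀ π, (∀ i : Fin m, c i ≤ V i.succ π) → V 0 π ≤ p) :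
    ∃ lam : Fin m → ℝ, 0 ≤ lam ∧ ∀ π, V 0 π + ∑ i, lam i * (V i.succ π - c i) ≤ p := by
  obtain ⟨π₀, hπ₀⟩ := hslater
  -- After translation by `-b`, a vector with all coordinates positive would be a feasible policy
  -- with objective above `p`.
  let b : Fin (m + 1) → ℝ := Fin.cons p c
  have hC : Convex ℝ ((fun x => -b + x) '' Set.range fun (π : P) (i : Fin (m + 1)) => V i π) :=
    hconv.translate _
  obtain ⟨w, hw0, hwne, hw⟩ := exists_nonneg_sum_mul_nonpos_of_convex hC
    ⟨_, _, ⟨π₀, rfl⟩, rfl⟩ (by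
      rintro _ ⟨_, ⟨π, rfl⟩, rfl⟩
      by_contra! h
      have h0 := h 0
      have := hp π fun i => by
        have := h i.succ
        simp [b] at this
        linarith
      simp [b] at h0
      linarith)
  have hw' : ∀ π, w 0 * (V 0 π - p) + ∑ i : Fin m, w i.succ * (V i.succ π - c i) ≤ 0 := by
    intro π
    have := hw _ ⟨_, ⟨π, rfl⟩, rfl⟩
    rw [Fin.sum_univ_succ] at this
    simpa [b, sub_eq_neg_add] using this
  have hw00 : 0 < w 0 := by
    -- If `w 0 = 0`, the strict slacks at the Slater policy force every other weight to vanish as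
    -- well.
    refine lt_of_le_of_ne (hw0 0) fun h0 => hwne ?_
    have h1 := hw' π₀
    rw [← h0, zero_mul, zero_add] at h1
    have hnn : ∀ i ∈ Finset.univ, 0 ≤ w (Fin.succ i) * (V i.succ π₀ - c i) := fun i _ =>
      mul_nonneg (hw0 _) (sub_nonneg.2 (hπ₀ i).le)
    have h2 := (Finset.sum_eq_zero_iff_of_nonneg hnn).1 (le_antisymm h1 (Finset.sum_nonneg hnn))
    funext i
    refine Fin.cases h0.symm (fun i => ?_) i
    exact (mul_eq_zero.1 (h2 i (Finset.mem_univ _))).resolve_right (sub_pos.2 (hπ₀ i)).ne'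
  refine ⟨fun i => w i.succ / w 0, fun i => div_nonneg (hw0 _) hw00.le, fun π => ?_⟩
  have h1 : w 0 * (V 0 π - p + ∑ i : Fin m, w i.succ / w 0 * (V i.succ π - c i)) ≤ 0 := by
    refine le_trans (le_of_eq ?_) (hw' π)
    rw [mul_add, Finset.mul_sum]
    congr 1
    refine Finset.sum_congr rfl fun i _ => ?_
    field_simp
  have := nonpos_of_mul_nonpos_right h1 hw00
  linarith

/-! ### Occupancy measures and the Bellman flow equation. -/

namespace DiscountedMDP

variable {S A : Type*} [MeasurableSpace S] [MeasurableSpace A]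

/-- Law of the state-action pair `(s_τ, a_τ)` under the policy `π`. -/
noncomputable def marginalLaw (M : DiscountedMDP S A) (π : Policy S A) (τ : ℕ) :
    Measure (S × A) :=
  (M.pathLaw π).map fun ω => ω τ

instance (M : DiscountedMDP S A) (π : Policy S A) : IsProbabilityMeasure (M.pathLaw π) := by
  unfold pathLaw
  infer_instance

instance (M : DiscountedMDP S A) (π : Policy S A) (τ : ℕ) :
    IsProbabilityMeasure (M.marginalLaw π τ) :=
  Measure.isProbabilityMeasure_map (measurable_pi_apply τ).aemeasurable

theorem marginalLaw_zero (M : DiscountedMDP S A) (π : Policy S A) :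
    M.marginalLaw π 0 = M.init ⊗ₘ π.kernel := by
  have h : (fun ω : ℕ → S × A => ω 0) =
      (fun x => x ⟨0, by simp⟩) ∘ Preorder.frestrictLe (π := fun _ : ℕ => S × A) 0 := rfl
  rw [marginalLaw, pathLaw, Kernel.trajMeasure, h, ← Measure.map_map (by fun_prop) (by fun_prop),
    Measure.map_comp _ _ (by fun_prop), Kernel.traj_map_frestrictLe, Kernel.partialTraj_self,
    Measure.id_comp, Measure.map_map (by fun_prop) (by fun_prop)]
  exact Measure.map_id

theorem marginalLaw_succ (M : DiscountedMDP S A) (π : Policy S A) (τ : ℕ) :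
    M.marginalLaw π (τ + 1) = M.stepKernel π ∘ₘ M.marginalLaw π τ := by
  have h := Kernel.map_frestrictLe_trajMeasure_compProd_eq_map_trajMeasure
    (X := fun _ => S × A) (μ₀ := M.init ⊗ₘ π.kernel) (κ := M.historyKernel π) (a := τ)
  have h2 := congrArg Measure.snd h
  rw [Measure.snd_compProd, Measure.snd_map_prodMk (by fun_prop)] at h2
  refine h2.symm.trans ?_
  ext s hs
  rw [Measure.bind_apply hs (by fun_prop), Measure.bind_apply hs (by fun_prop), marginalLaw,
    lintegral_map (Kernel.measurable_coe _ hs) (by fun_prop),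
    lintegral_map (Kernel.measurable_coe _ hs) (by fun_prop)]
  rfl

/-- Discounted occupancy measure of a policy. -/
noncomputable def occupancy (M : DiscountedMDP S A) (π : Policy S A) : Measure (S × A) :=
  Measure.sum fun τ => ENNReal.ofReal (M.γ ^ τ) • M.marginalLaw π τ

theorem occupancy_univ (M : DiscountedMDP S A) (π : Policy S A) :
    M.occupancy π Set.univ = ENNReal.ofReal (1 - M.γ)⁻¹ := by
  rw [occupancy, Measure.sum_apply _ MeasurableSet.univ]
  simp only [Measure.smul_apply, measure_univ, smul_eq_mul, mul_one]
  rw [← ENNReal.ofReal_tsum_of_nonneg (fun n => pow_nonneg M.γ_pos.le n)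
    (summable_geometric_of_lt_one M.γ_pos.le M.γ_lt_one),
    tsum_geometric_of_lt_one M.γ_pos.le M.γ_lt_one]

instance (M : DiscountedMDP S A) (π : Policy S A) : IsFiniteMeasure (M.occupancy π) :=
  ⟨by rw [occupancy_univ]; exact ENNReal.ofReal_lt_top⟩

/-- The Bellman flow equation. -/
theorem occupancy_eq (M : DiscountedMDP S A) (π : Policy S A) :
    M.occupancy π =
      M.init ⊗ₘ π.kernel + ENNReal.ofReal M.γ • (M.stepKernel π ∘ₘ M.occupancy π) := by
  ext s hs
  rw [Measure.add_apply, Measure.smul_apply, Measure.bind_apply hs (by fun_prop), occupancy,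
    lintegral_sum_measure, Measure.sum_apply _ hs, _root_.tsum_eq_zero_add' ENNReal.summable,
    smul_eq_mul, ← ENNReal.tsum_mul_left]
  congr 1
  · simp [marginalLaw_zero]
  · refine tsum_congr fun τ => ?_
    rw [Measure.smul_apply, marginalLaw_succ, lintegral_smul_measure,
      Measure.bind_apply hs (by fun_prop), smul_eq_mul, smul_eq_mul, pow_succ',
      ENNReal.ofReal_mul M.γ_pos.le, mul_assoc]

/-- Markov kernels preserve mass, so the total mass `x` solves `x = 1 + γ x`. -/
theorem univ_eq_of_flow (M : DiscountedMDP S A) (π : Policy S A) (ρ : Measure (S × A))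
    [IsFiniteMeasure ρ]
    (h : ρ = M.init ⊗ₘ π.kernel + ENNReal.ofReal M.γ • (M.stepKernel π ∘ₘ ρ)) :
    ρ Set.univ = ENNReal.ofReal (1 - M.γ)⁻¹ := by
  have h1 := congrArg (fun ν : Measure (S × A) => (ν Set.univ).toReal) h
  simp only [Measure.add_apply, Measure.smul_apply, Measure.comp_apply_univ, measure_univ,
    smul_eq_mul] at h1
  rw [ENNReal.toReal_add (by simp) (by finiteness), ENNReal.toReal_mul,
    ENNReal.toReal_ofReal M.γ_pos.le, ENNReal.toReal_one] at h1
  have h2 : (1 - M.γ) ≠ 0 := (sub_pos.2 M.γ_lt_one).ne'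
  rw [← ENNReal.ofReal_toReal (measure_ne_top ρ Set.univ)]
  congr 1
  field_simp
  linarith

/-- The occupancy measure is the only finite solution of the Bellman flow equation. -/
theorem eq_occupancy_of_flow (M : DiscountedMDP S A) (π : Policy S A) (ρ : Measure (S × A))
    [IsFiniteMeasure ρ]
    (h : ρ = M.init ⊗ₘ π.kernel + ENNReal.ofReal M.γ • (M.stepKernel π ∘ₘ ρ)) :
    M.occupancy π = ρ := by
  -- Iterating the flow equation bounds every partial sum of the occupancy by `ρ`; equal finite
  -- total mass then turns domination into equality.
  have hle : ∀ (N : ℕ) (s : Set (S × A)), MeasurableSet s →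
      ∑ τ ∈ Finset.range N, ENNReal.ofReal (M.γ ^ τ) * M.marginalLaw π τ s ≤ ρ s := by
    intro N
    induction N with
    | zero => simp
    | succ N ih =>
      have hmeas : ∑ τ ∈ Finset.range N, ENNReal.ofReal (M.γ ^ τ) • M.marginalLaw π τ ≤ ρ :=
        Measure.le_iff.2 fun s hs => by
          simpa [Measure.finsetSum_apply] using ih s hs
      intro s hs
      rw [h, Finset.sum_range_succ', add_comm, Measure.add_apply, Measure.smul_apply,
        Measure.bind_apply hs (by fun_prop), smul_eq_mul]
      refine add_le_add (by simp [marginalLaw_zero]) ?_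
      refine le_trans (le_of_eq ?_) (mul_le_mul_right (lintegral_mono' hmeas le_rfl) _)
      rw [lintegral_finsetSum_measure, Finset.mul_sum]
      refine Finset.sum_congr rfl fun τ _ => ?_
      rw [lintegral_smul_measure, marginalLaw_succ, Measure.bind_apply hs (by fun_prop),
        smul_eq_mul, pow_succ', ENNReal.ofReal_mul M.γ_pos.le, mul_assoc]
  refine Measure.eq_of_le_of_measure_univ_eq (Measure.le_iff.2 fun s hs => ?_)
    ((M.occupancy_univ π).trans (M.univ_eq_of_flow π ρ h).symm)
  rw [occupancy, Measure.sum_apply _ hs]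
  exact ENNReal.tsum_le_of_sum_range_le fun N => by simpa using hle N s hs

/-- Pulling the policy out turns the flow equation into `ρ = (init + γ • (trans ∘ₘ ρ)) ⊗ₘ π`. -/
theorem stepKernel_comp (M : DiscountedMDP S A) (π : Policy S A) (ρ : Measure (S × A))
    [SFinite ρ] :
    M.stepKernel π ∘ₘ ρ = (M.trans ∘ₘ ρ) ⊗ₘ π.kernel := by
  ext s hs
  rw [Measure.bind_apply hs (by fun_prop), Measure.compProd_apply hs,
    Measure.lintegral_bind (by fun_prop)
      (Kernel.measurable_kernel_prodMk_left hs).aemeasurable]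
  refine lintegral_congr fun x => ?_
  rw [stepKernel, Kernel.compProd_apply hs]
  rfl

theorem occupancy_fst (M : DiscountedMDP S A) (π : Policy S A) :
    (M.occupancy π).fst = M.init + ENNReal.ofReal M.γ • (M.trans ∘ₘ M.occupancy π) := by
  conv_lhs => rw [occupancy_eq, stepKernel_comp]
  rw [Measure.fst_add, Measure.fst_compProd, ← Measure.compProd_smul_left, Measure.fst_compProd]

/-- The set of occupancy measures is convex. -/
theorem exists_occupancy_eq_add [StandardBorelSpace A] (M : DiscountedMDP S A) (π₁ π₂ : Policy S A)
    {a b : ENNReal} (hab : a + b = 1) :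
    ∃ π : Policy S A, M.occupancy π = a • M.occupancy π₁ + b • M.occupancy π₂ := by
  have : Nonempty (S × A) := nonempty_of_isProbabilityMeasure (M.marginalLaw π₁ 0)
  have : Nonempty A := this.map Prod.snd
  have ha : a ≠ ⊤ := by rintro rfl; simp at hab
  have hb : b ≠ ⊤ := by rintro rfl; simp at hab
  set ρ := a • M.occupancy π₁ + b • M.occupancy π₂ with hρ
  have : IsFiniteMeasure (a • M.occupancy π₁) := Measure.smul_finite _ ha
  have : IsFiniteMeasure (b • M.occupancy π₂) := Measure.smul_finite _ hb
  have : IsFiniteMeasure ρ := by rw [hρ]; infer_instance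
  -- The policy is the conditional law of the action given the state under `ρ`, which in general is
  -- not the pointwise mixture of the two kernels.
  refine ⟨⟨ρ.condKernel, inferInstance⟩, M.eq_occupancy_of_flow _ ρ ?_⟩
  have hsmul : ∀ (c : ENNReal) (ν : Measure (S × A)), (c • ν).fst = c • ν.fst := fun c ν =>
    Measure.map_smul ..
  have hfst : ρ.fst = M.init + ENNReal.ofReal M.γ • (M.trans ∘ₘ ρ) := by
    rw [hρ, Measure.fst_add, hsmul, hsmul, occupancy_fst, occupancy_fst,
      Measure.comp_add, Measure.comp_smul, Measure.comp_smul]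
    simp only [smul_add, smul_comm a (ENNReal.ofReal M.γ), smul_comm b (ENNReal.ofReal M.γ)]
    rw [add_add_add_comm, ← add_smul, hab, one_smul]
  rw [stepKernel_comp, ← Measure.compProd_smul_left, ← Measure.compProd_add_left, ← hfst]
  exact (ρ.disintegrate ρ.condKernel).symm

theorem expectedReturn_eq_integral_occupancy (M : DiscountedMDP S A) {f : S × A → ℝ}
    (hf : Measurable f) {B : ℝ} (hB : ∀ x, |f x| ≤ B) (π : Policy S A) :
    M.expectedReturn f π = ∫ x, f x ∂M.occupancy π := by
  have hint : ∀ ν : Measure (S × A), IsFiniteMeasure ν → Integrable f ν := fun ν _ =>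
    Integrable.of_bound hf.aestronglyMeasurable B (.of_forall hB)
  have hfτ : ∀ τ, Integrable (fun ω : ℕ → S × A => M.γ ^ τ * f (ω τ)) (M.pathLaw π) := fun τ =>
    (Integrable.of_bound (hf.comp (measurable_pi_apply τ)).aestronglyMeasurable B (.of_forall fun ω => hB _)).const_mul _
  have hsum : Summable fun τ => ∫ ω, ‖M.γ ^ τ * f (ω τ)‖ ∂M.pathLaw π := by
    refine Summable.of_nonneg_of_le (fun τ => integral_nonneg fun ω => norm_nonneg _)
      (fun τ => ?_) ((summable_geometric_of_lt_one M.γ_pos.le M.γ_lt_one).mul_right B)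
    calc ∫ ω, ‖M.γ ^ τ * f (ω τ)‖ ∂M.pathLaw π ≤ ∫ ω, M.γ ^ τ * B ∂M.pathLaw π := by
          refine integral_mono (hfτ τ).norm (integrable_const _) fun ω => ?_
          have := pow_nonneg M.γ_pos.le τ
          simp only [norm_mul, norm_pow, Real.norm_eq_abs, abs_of_pos M.γ_pos]
          exact mul_le_mul_of_nonneg_left (hB _) this
      _ = M.γ ^ τ * B := by simp
  rw [expectedReturn, ← integral_tsum_of_summable_integral_norm hfτ hsum, occupancy,
    integral_sum_measure (hint _ (inferInstanceAs (IsFiniteMeasure (M.occupancy π))))]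
  refine tsum_congr fun τ => ?_
  rw [integral_smul_measure, marginalLaw,
    integral_map (measurable_pi_apply τ).aemeasurable hf.aestronglyMeasurable,
    ENNReal.toReal_ofReal (pow_nonneg M.γ_pos.le τ), integral_const_mul, smul_eq_mul]

/-- The set of return vectors of bounded measurable rewards achieved by policies is convex. -/
theorem convex_range_expectedReturn [StandardBorelSpace A] {ι : Type*} (M : DiscountedMDP S A)
    {f : ι → S × A → ℝ} (hf : ∀ i, Measurable (f i)) (hB : ∀ i, ∃ B : ℝ, ∀ x, |f i x| ≤ B) :
    Convex ℝ (Set.range fun (π : Policy S A) i => M.expectedReturn (f i) π) := by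
  rintro _ ⟨π₁, rfl⟩ _ ⟨π₂, rfl⟩ a b ha hb hab
  obtain ⟨π, hπ⟩ := M.exists_occupancy_eq_add π₁ π₂
    (a := ENNReal.ofReal a) (b := ENNReal.ofReal b)
    (by rw [← ENNReal.ofReal_add ha hb, hab, ENNReal.ofReal_one])
  refine ⟨π, funext fun i => ?_⟩
  obtain ⟨B, hBi⟩ := hB i
  have hint : ∀ π : Policy S A, Integrable (f i) (M.occupancy π) := fun _ =>
    Integrable.of_bound (hf i).aestronglyMeasurable B (.of_forall hBi)
  simp only [Pi.add_apply, Pi.smul_apply, smul_eq_mul,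
    M.expectedReturn_eq_integral_occupancy (hf i) hBi]
  rw [hπ, integral_add_measure ((hint _).smul_measure (by simp))
    ((hint _).smul_measure (by simp)), integral_smul_measure, integral_smul_measure,
    ENNReal.toReal_ofReal ha, ENNReal.toReal_ofReal hb, smul_eq_mul, smul_eq_mul]

theorem expectedReturn_le (M : DiscountedMDP S A) {f : S × A → ℝ} (hf : Measurable f) {B : ℝ}
    (hB : ∀ x, |f x| ≤ B) (π : Policy S A) :
    M.expectedReturn f π ≤ B * (1 - M.γ)⁻¹ := by
  rw [M.expectedReturn_eq_integral_occupancy hf hB]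
  refine (Real.le_norm_self _).trans
    ((norm_integral_le_of_norm_le_const (.of_forall hB)).trans (le_of_eq ?_))
  rw [measureReal_def, occupancy_univ,
    ENNReal.toReal_ofReal (inv_nonneg.2 (sub_nonneg.2 M.γ_lt_one.le))]

end DiscountedMDP

/-! ### Modified rewards and strong duality. -/

theorem measurable_modifiedReward {X : Type*} [MeasurableSpace X] {r : X → ℝ} (hr : Measurable r)
    (β t : ℝ) : Measurable (modifiedReward β r t) := by
  unfold modifiedReward
  fun_prop

theorem exists_abs_modifiedReward_le {X : Type*} {r : X → ℝ} (hr : ∃ B : ℝ, ∀ x, |r x| ≤ B)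
    (β t : ℝ) : ∃ B : ℝ, ∀ x, |modifiedReward β r t x| ≤ B := by
  obtain ⟨B, hB⟩ := hr
  refine ⟨|t| + |1 / β| * (|t| + B), fun x => ?_⟩
  refine (abs_sub _ _).trans ?_
  rw [abs_mul]
  gcongr
  refine (abs_max_le_max_abs_abs).trans (max_le ((abs_sub _ _).trans ?_) ?_)
  · gcongr; exact hB x
  · rw [abs_zero]
    exact add_nonneg (abs_nonneg _) ((abs_nonneg _).trans (hB x))

theorem proposition1 {n d m : ℕ}
    (S : Set (EuclideanSpace ℝ (Fin n))) (hS : IsCompact S)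
    (A : Set (EuclideanSpace ℝ (Fin d))) (hA : IsCompact A)
    (M : DiscountedMDP S A)
    (β : ℝ) (hβ0 : 0 < β) (hβ1 : β ≤ 1)
    (r : Fin (m + 1) → S × A → ℝ)
    (hr_meas : ∀ i, Measurable (r i))
    (hr_bdd : ∀ i, ∃ B : ℝ, ∀ x, |r i x| ≤ B)
    (c : Fin m → ℝ) (t : Fin (m + 1) → ℝ)
    (hSlater : M.SlaterCondition β r c t) :
    -- the constrained problem has the same optimal value as its Lagrangian dual,
    M.primalValue β r c t = M.dualValue β r c t ∧
    -- the dual optimum is attained,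
    (∃ lam : Fin m → ℝ, 0 ≤ lam ∧ M.dualFunction β r c t lam = M.dualValue β r c t) ∧
    -- and supremum over policies and infimum over multipliers can be exchanged.
    (⨆ π : Policy S A, ⨅ (lam : Fin m → ℝ) (_ : 0 ≤ lam),
        (M.lagrangian β r c π t lam : EReal)) =
      ⨅ (lam : Fin m → ℝ) (_ : 0 ≤ lam), ⨆ π : Policy S A,
        (M.lagrangian β r c π t lam : EReal) := by
  -- This provides the conditional kernels behind the convexity of the value set.
  have : StandardBorelSpace A := hA.measurableSet.standardBorel
  have hm := fun i => measurable_modifiedReward (hr_meas i) β (t i)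
  have hb := fun i => exists_abs_modifiedReward_le (hr_bdd i) β (t i)
  obtain ⟨B, hB⟩ := hb 0
  have hbdd : BddAbove ((fun π => M.riskValue β r t 0 π) '' {π | M.IsFeasible β r c t π}) :=
    ⟨B * (1 - M.γ)⁻¹, by
      rintro _ ⟨π, -, rfl⟩
      exact M.expectedReturn_le (hm 0) hB π⟩
  obtain ⟨π₀, hπ₀⟩ := hSlater
  set p := sSup ((fun π => M.riskValue β r t 0 π) '' {π | M.IsFeasible β r c t π}) with hp
  obtain ⟨lam, hlam0, hlam⟩ := exists_lagrange_multiplier (M.riskValue β r t) c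
    (M.convex_range_expectedReturn hm hb) ⟨π₀, hπ₀⟩ p
    fun π hπ => le_csSup hbdd ⟨π, hπ, rfl⟩
  have hdual : M.dualFunction β r c t lam ≤ (p : EReal) :=
    iSup_le fun π => EReal.coe_le_coe_iff.2 (hlam π)
  have hprimal : (p : EReal) ≤ M.primalValue β r c t := by
    refine EReal.ge_of_forall_gt_iff_ge.1 fun x hx => ?_
    obtain ⟨_, ⟨π, hπ, rfl⟩, hxy⟩ := exists_lt_of_lt_csSup
      (Set.Nonempty.image _ ⟨π₀, show M.IsFeasible β r c t π₀ from fun i => (hπ₀ i).le⟩) (EReal.coe_lt_coe_iff.1 hx)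
    exact (EReal.coe_le_coe_iff.2 hxy.le).trans (le_iSup₂_of_le π hπ le_rfl)
  have hsupinf : M.primalValue β r c t ≤ ⨆ π : Policy S A, ⨅ (lam : Fin m → ℝ) (_ : 0 ≤ lam),
      (M.lagrangian β r c π t lam : EReal) :=
    iSup₂_le fun π hπ => le_iSup_of_le π <| le_iInf₂ fun l hl => EReal.coe_le_coe_iff.2 <|
      le_add_of_nonneg_right <| Finset.sum_nonneg fun i _ =>
        mul_nonneg (hl i) (sub_nonneg.2 (hπ i))
  have hweak : (⨆ π : Policy S A, ⨅ (lam : Fin m → ℝ) (_ : 0 ≤ lam),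
      (M.lagrangian β r c π t lam : EReal)) ≤ M.dualValue β r c t :=
    le_iInf₂ fun l hl => iSup_mono fun π => iInf₂_le l hl
  have hattain : M.dualValue β r c t ≤ M.dualFunction β r c t lam := iInf₂_le lam hlam0
  -- The cycle `p ≤ primal ≤ sup inf ≤ dual ≤ dualFunction lam ≤ p` makes all these values equal.
  refine ⟨le_antisymm (hsupinf.trans hweak) (hattain.trans (hdual.trans hprimal)),
    ⟨lam, hlam0, le_antisymm (hdual.trans (hprimal.trans (hsupinf.trans hweak))) hattain⟩,
    le_antisymm hweak (hattain.trans (hdual.trans (hprimal.trans hsupinf)))⟩
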